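/- A represented space is a set $X$ with a partial surjection $\delta_X:\subseteq\mathbb N^{\mathbb N}\to X$; the elements of $\delta_X^{-1}(x)$ are the names of $x$. A realizer of a partial multivalued function $f:\subseteq X\rightrightarrows Y$ between represented spaces is a partial function $F:\subseteq\mathbb N^{\mathbb N}\to\mathbb N^{\mathbb N}$ such that, whenever $p$ is a name of some $x\in\operatorname{dom}(f)$, $F(p)$ is defined and is a name of some element of $f(x)$. Write $f\le_{\mathrm W}g$ if there are computable partial functions $K,H:\subseteq\mathbb N^{\mathbb N}\to\mathbb N^{\mathbb N}$ such that $p\mapsto K\langle p,G(H(p))\rangle$ is a realizer of $f$ for every realizer $G$ of $g$, and $f\equiv_{\mathrm W}g$ if $f\le_{\mathrm W}g$ and $g\le_{\mathrm W}f$. Let $\mathbf{Tr}$ be the space of trees on $\mathbb N$ (sets of finite sequences of natural numbers closed under initial segments), represented by their characteristic functions; for $T\in\mathbf{Tr}$ let $[T]\subseteq\mathbb N^{\mathbb N}$ be its set of infinite paths. A tree is perfect if it is nonempty and each of its nodes has two incomparable extensions in the tree. Let $\mathcal A(\mathbb N^{\mathbb N})$ be the space of closed subsets of $\mathbb N^{\mathbb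 N}$ with negative information: a name of $A$ is a name of the characteristic function of the open set $\mathbb N^{\mathbb N}\setminus A$ as a continuous function from $\mathbb N^{\mathbb N}$ to Sierpiński space $\{\top,\bot\}$, where $0^\omega$ is the only name of $\bot$ and every other sequence is a name of $\top$. The one-sided perfect tree theorem $\mathsf{PTT}_1:\subseteq\mathbf{Tr}\rightrightarrows\mathbf{Tr}$ has as domain the trees $T$ for which $[T]$ is uncountable and maps such a $T$ to all perfect trees $T'\subseteq T$. Closed choice $\mathsf C_{\mathbb N^{\mathbb N}}:\subseteq\mathcal A(\mathbb N^{\mathbb N})\rightrightarrows\mathbb N^{\mathbb N}$ has as domain the nonempty closed sets and maps such a set $A$ to all its elements. **Proposition.** $\mathsf{PTT}_1\equiv_{\mathrm W}\mathsf C_{\mathbb N^{\mathbb N}}$. -/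

import Mathlib

/-! Represented spaces, computability on Baire space, Weihrauch reducibility, closed choice and
the one-sided perfect tree theorem. -/

namespace Weihrauch

/-! ### Baire space and computable partial functions on it -/

/-- Baire space `ℕ^ℕ`, with its product topology. -/
abbrev Baire : Type := ℕ → ℕ

/-- The initial segment of length `n` of `p`. -/
def initSeg (p : Baire) (n : ℕ) : List ℕ := (List.range n).map p

/-- In the limit, the word function `φ` outputs `y` on input `p`: every word `φ (p ↾ n)` is an
initial segment of `y`, and these words get arbitrarily long. -/
def Produces (φ : List ℕ → List ℕ) (p y : Baire) : Prop :=
  (∀ n, φ (initSeg p n) = initSeg y (φ (initSeg p n)).length) ∧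
    ∀ k, ∃ n, k ≤ (φ (initSeg p n)).length

theorem initSeg_length (p : Baire) (n : ℕ) : (initSeg p n).length = n := by
  simp [initSeg]

theorem initSeg_eq_iff (p q : Baire) (n : ℕ) :
    initSeg p n = initSeg q n ↔ ∀ i < n, p i = q i := by
  simp [initSeg]

theorem Produces.unique {φ : List ℕ → List ℕ} {p y z : Baire}
    (hy : Produces φ p y) (hz : Produces φ p z) : y = z := by
  funext i
  obtain ⟨n, hn⟩ := hy.2 (i + 1)
  exact (initSeg_eq_iff y z _).1 ((hy.1 n).symm.trans (hz.1 n)) i hn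

/-- The partial function on Baire space given by the word function `φ`; it is defined at `p`
exactly when the words `φ (p ↾ n)` converge to an infinite sequence. -/
noncomputable def limitFun (φ : List ℕ → List ℕ) : Baire →. Baire :=
  fun p => ⟨∃ y, Produces φ p y, fun h => h.choose⟩

theorem mem_limitFun {φ : List ℕ → List ℕ} {p y : Baire} :
    y ∈ limitFun φ p ↔ Produces φ p y := by
  constructor
  · rintro ⟨h, rfl⟩
    exact h.choose_spec
  · intro h
    exact ⟨⟨y, h⟩, Produces.unique (Exists.choose_spec (⟨y, h⟩ : ∃ y, Produces φ p y)) h⟩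

/-- `F` is computable: some (Turing-)computable word function produces `F p` in the limit from
the initial segments of `p`, for every `p` in the domain of `F`. -/
def IsComputable (F : Baire →. Baire) : Prop :=
  ∃ φ : List ℕ → List ℕ, Computable φ ∧ ∀ p, ∀ y ∈ F p, y ∈ limitFun φ p

/-- `F` is continuous on its domain (with the subspace topology). -/
def IsContinuous (F : Baire →. Baire) : Prop :=
  Continuous fun p : F.Dom => F.fn p.1 p.2

/-- The word function coded by `q`. -/
def wordFun (q : Baire) : List ℕ → List ℕ :=
  fun w => Denumerable.ofNat (List ℕ) (q (Encodable.encode w))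

theorem exists_wordFun (φ : List ℕ → List ℕ) : ∃ q, wordFun q = φ := by
  refine ⟨fun n => Encodable.encode (φ (Denumerable.ofNat (List ℕ) n)), ?_⟩
  funext w
  simp [wordFun]

/-- The pairing `⟨p, q⟩ = p 0, q 0, p 1, q 1, …` on Baire space. -/
def pair (p q : Baire) : Baire := fun n => if n % 2 = 0 then p (n / 2) else q (n / 2)

/-- Every continuous partial function is a restriction of one that is given by a word function. -/
theorem exists_code_of_isContinuous {F : Baire →. Baire} (hF : IsContinuous F) :
    ∃ q, ∀ p, ∀ y ∈ F p, y ∈ limitFun (wordFun q) p := by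
  classical
  let P : List ℕ → ℕ → Prop := fun w k => ∀ p p' y y' : Baire,
    initSeg p w.length = w → initSeg p' w.length = w → y ∈ F p → y' ∈ F p' →
      initSeg y k = initSeg y' k
  let φ : List ℕ → List ℕ := fun w =>
    if h : ∃ y p, initSeg p w.length = w ∧ y ∈ F p then
      initSeg h.choose (Nat.findGreatest (P w) w.length) else []
  have hφ : ∀ p, ∀ y ∈ F p, ∀ n,
      φ (initSeg p n) = initSeg y (Nat.findGreatest (P (initSeg p n)) n) := by
    intro p y hy n
    have hp : initSeg p (initSeg p n).length = initSeg p n := by rw [initSeg_length]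
    have h : ∃ y p', initSeg p' (initSeg p n).length = initSeg p n ∧ y ∈ F p' := ⟨y, p, hp, hy⟩
    have hP : P (initSeg p n) (Nat.findGreatest (P (initSeg p n)) n) :=
      Nat.findGreatest_spec (Nat.zero_le n) (fun _ _ _ _ _ _ _ _ => by simp [initSeg])
    obtain ⟨p', hp', hy'⟩ := h.choose_spec
    simp only [φ, dif_pos h]
    exact (congrArg (fun m => initSeg h.choose (Nat.findGreatest (P (initSeg p n)) m))
      (initSeg_length p n)).trans (hP _ _ _ _ hp' hp hy' hy)
  obtain ⟨q, hq⟩ := exists_wordFun φ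
  refine ⟨q, fun p y hy => mem_limitFun.2 ?_⟩
  rw [hq]
  refine ⟨fun n => ?_, fun k => ?_⟩
  · rw [hφ p y hy n, initSeg_length]
  · obtain ⟨hd, rfl⟩ := hy
    have hU : IsOpen ((fun p : F.Dom => F.fn p.1 p.2) ⁻¹' PiNat.cylinder (F.fn p hd) k) :=
      (PiNat.isOpen_cylinder (fun _ => ℕ) _ k).preimage hF
    obtain ⟨V, hV, hVU⟩ := isOpen_induced_iff.1 hU
    have hpV : p ∈ V := by
      have : (⟨p, hd⟩ : F.Dom) ∈ Subtype.val ⁻¹' V := by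
        rw [hVU]
        exact PiNat.self_mem_cylinder _ _
      exact this
    obtain ⟨s, ⟨x, n, rfl⟩, hps, hsV⟩ :=
      (PiNat.isTopologicalBasis_cylinders (fun _ => ℕ)).exists_subset_of_mem_open hpV hV
    have key : ∀ p' y', initSeg p' (max n k) = initSeg p (max n k) → y' ∈ F p' →
        initSeg y' k = initSeg (F.fn p hd) k := by
      rintro p' _ hp' ⟨hd', rfl⟩
      have hp'V : p' ∈ V := by
        refine hsV fun i hi => ?_
        rw [(initSeg_eq_iff _ _ _).1 hp' i (lt_of_lt_of_le hi (le_max_left _ _))]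
        exact hps i hi
      have : (⟨p', hd'⟩ : F.Dom) ∈ Subtype.val ⁻¹' V := hp'V
      rw [hVU] at this
      exact (initSeg_eq_iff _ _ _).2 this
    refine ⟨max n k, ?_⟩
    rw [hφ p _ ⟨hd, rfl⟩, initSeg_length]
    refine Nat.le_findGreatest (le_max_right _ _) ?_
    intro p₁ p₂ y₁ y₂ h₁ h₂ hy₁ hy₂
    rw [initSeg_length] at h₁ h₂
    rw [key p₁ y₁ h₁ hy₁, key p₂ y₂ h₂ hy₂]

/-! ### Represented spaces and problems -/

/-- A represented space: a set with a partial surjection `δ` from Baire space onto it, given by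
its graph; `IsName p x` says that `δ p` is defined and equal to `x`. -/
structure RepSpace where
  carrier : Type
  IsName : Baire → carrier → Prop
  unique : ∀ {p x y}, IsName p x → IsName p y → x = y
  surjective : ∀ x, ∃ p, IsName p x

/-- A partial multivalued function between represented spaces. -/
structure MultiFun (X Y : RepSpace) where
  dom : Set X.carrier
  val : X.carrier → Set Y.carrier
  nonempty : ∀ x ∈ dom, (val x).Nonempty

/-- A total single-valued function as a multivalued function. -/
def MultiFun.ofFun {X Y : RepSpace} (f : X.carrier → Y.carrier) : MultiFun X Y where
  dom := Set.univ
  val x := {f x}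
  nonempty x _ := ⟨f x, rfl⟩

/-- `F ⊢ f`: the partial function `F` maps each name of each `x` in the domain of `f` to a name
of a value of `f` at `x`. -/
def Realizes {X Y : RepSpace} (F : Baire →. Baire) (f : MultiFun X Y) : Prop :=
  ∀ p x, X.IsName p x → x ∈ f.dom → ∃ q ∈ F p, ∃ y ∈ f.val x, Y.IsName q y

theorem Realizes.mono {X Y : RepSpace} {F G : Baire →. Baire} {f : MultiFun X Y}
    (h : ∀ p, ∀ y ∈ F p, y ∈ G p) (hF : Realizes F f) : Realizes G f := by
  intro p x hp hx
  obtain ⟨q, hq, hy⟩ := hF p x hp hx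
  exact ⟨q, h p q hq, hy⟩

/-- Weihrauch reducibility: there are computable `K`, `H` such that
`p ↦ K ⟨p, G (H p)⟩` realizes `f` whenever `G` realizes `g`. -/
def WeihrauchReducible {X Y Z W : RepSpace} (f : MultiFun X Y) (g : MultiFun Z W) : Prop :=
  ∃ K H : Baire →. Baire, IsComputable K ∧ IsComputable H ∧
    ∀ G : Baire →. Baire, Realizes G g →
      Realizes (fun p => (H p).bind fun r => (G r).bind fun s => K (pair p s)) f

/-- Weihrauch equivalence. -/
def WeihrauchEquivalent {X Y Z W : RepSpace} (f : MultiFun X Y) (g : MultiFun Z W) : Prop :=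
  WeihrauchReducible f g ∧ WeihrauchReducible g f

/-! ### Function spaces, open and closed sets, closed choice -/

/-- The represented space `C(X, Y)` of the functions with a continuous realizer. A name of `f`
is a code of a word function whose partial function realizes `f`. -/
def functionSpace (X Y : RepSpace) : RepSpace where
  carrier := {f : X.carrier → Y.carrier //
    ∃ F : Baire →. Baire, IsContinuous F ∧ Realizes F (MultiFun.ofFun f)}
  IsName q f := Realizes (limitFun (wordFun q)) (MultiFun.ofFun f.1)
  unique := by
    intro q f g hf hg
    apply Subtype.ext
    funext x
    obtain ⟨p, hp⟩ := X.surjective x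
    obtain ⟨r, hr, y, hy, hry⟩ := hf p x hp trivial
    obtain ⟨r', hr', y', hy', hry'⟩ := hg p x hp trivial
    obtain rfl := Part.mem_unique hr hr'
    have hfy : y = f.1 x := hy
    have hgy : y' = g.1 x := hy'
    rw [← hfy, ← hgy]
    exact Y.unique hry hry'
  surjective := by
    rintro ⟨f, F, hF, hFf⟩
    obtain ⟨q, hq⟩ := exists_code_of_isContinuous hF
    exact ⟨q, hFf.mono hq⟩

/-- Baire space, represented by the identity. -/
def baireSpace : RepSpace where
  carrier := Baire
  IsName p x := p = x
  unique := by
    rintro p x y rfl rfl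
    rfl
  surjective x := ⟨x, rfl⟩

/-- Sierpiński space: the truth values, the only name of `False` being `000…`. -/
def sierpinski : RepSpace where
  carrier := Prop
  IsName p b := b ↔ ∃ n, p n ≠ 0
  unique h h' := propext (h.trans h'.symm)
  surjective b := by
    by_cases hb : b
    · exact ⟨fun _ => 1, by simp [hb]⟩
    · exact ⟨fun _ => 0, by simp [hb]⟩

/-- The represented space `O(X)` of open subsets of `X`, that is, of the sets with a continuous
characteristic function into Sierpiński space; the names are those of this function. -/
def openSets (X : RepSpace) : RepSpace where
  carrier := {U : Set X.carrier // ∃ χ : (functionSpace X sierpinski).carrier,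
    ∀ x, χ.1 x ↔ x ∈ U}
  IsName q U := ∃ χ : (functionSpace X sierpinski).carrier,
    (∀ x, χ.1 x ↔ x ∈ U.1) ∧ (functionSpace X sierpinski).IsName q χ
  unique := by
    rintro q U V ⟨χ, hχ, hq⟩ ⟨χ', hχ', hq'⟩
    obtain rfl := (functionSpace X sierpinski).unique hq hq'
    exact Subtype.ext (Set.ext fun x => (hχ x).symm.trans (hχ' x))
  surjective := by
    rintro ⟨U, χ, hχ⟩
    obtain ⟨q, hq⟩ := (functionSpace X sierpinski).surjective χ
    exact ⟨q, χ, hχ, hq⟩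

/-- The represented space `A(X)` of closed subsets of `X`: a name of `A` is a name of the open
set `X \ A` (negative information). -/
def closedSets (X : RepSpace) : RepSpace where
  carrier := {A : Set X.carrier // ∃ U : (openSets X).carrier, U.1 = Aᶜ}
  IsName q A := ∃ U : (openSets X).carrier, U.1 = A.1ᶜ ∧ (openSets X).IsName q U
  unique := by
    rintro q A B ⟨U, hU, hq⟩ ⟨V, hV, hq'⟩
    obtain rfl := (openSets X).unique hq hq'
    exact Subtype.ext (compl_injective (hU.symm.trans hV))
  surjective := by
    rintro ⟨A, U, hU⟩
    obtain ⟨q, hq⟩ := (openSets X).surjective U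
    exact ⟨q, U, hU, hq⟩

/-- Closed choice `C_X`: given a nonempty closed set, find one of its points. -/
def closedChoice (X : RepSpace) : MultiFun (closedSets X) X where
  dom := {A | A.1.Nonempty}
  val A := A.1
  nonempty _ h := h

/-! ### Trees and the perfect tree theorem -/

/-- The represented space of trees on `ℕ` (sets of words closed under prefixes), represented by
characteristic functions on the (coded) words. -/
def treeSpace : RepSpace where
  carrier := Descriptive.tree ℕ
  IsName p T := ∀ w : List ℕ,
    (w ∈ T → p (Encodable.encode w) = 1) ∧ (w ∉ T → p (Encodable.encode w) = 0)
  unique := by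
    intro p S T hS hT
    refine SetLike.ext fun w => ?_
    have h₁ := hS w
    have h₂ := hT w
    by_cases hs : w ∈ S <;> by_cases ht : w ∈ T <;> simp_all
  surjective T := by
    classical
    refine ⟨fun n => if Denumerable.ofNat (List ℕ) n ∈ T then 1 else 0, fun w => ?_⟩
    constructor <;> intro h <;> simp [h]

/-- The set `[T]` of infinite paths of `T`. -/
def body (T : Descriptive.tree ℕ) : Set Baire := {x | ∀ n, initSeg x n ∈ T}

/-- A perfect tree: a nonempty tree in which every node has two incomparable extensions. -/
def IsPerfectTree (T : Descriptive.tree ℕ) : Prop :=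
  (∃ v, v ∈ T) ∧ ∀ v ∈ T, ∃ u ∈ T, ∃ w ∈ T, v <+: u ∧ v <+: w ∧ ¬ u <+: w ∧ ¬ w <+: u

theorem initSeg_prefix (x : Baire) {m n : ℕ} (h : m ≤ n) : initSeg x m <+: initSeg x n := by
  obtain ⟨k, rfl⟩ := Nat.exists_eq_add_of_le h
  simp [initSeg, List.range_add]

theorem isClosed_body (T : Descriptive.tree ℕ) : IsClosed (body T) := by
  have h : body T = ⋂ n, {x | initSeg x n ∈ T} := by
    ext x
    simp [body]
  rw [h]
  refine isClosed_iInter fun n => ⟨?_⟩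
  rw [isOpen_iff_forall_mem_open]
  intro x hx
  refine ⟨PiNat.cylinder x n, fun y hy => ?_, PiNat.isOpen_cylinder _ _ _,
    PiNat.self_mem_cylinder _ _⟩
  have : initSeg y n = initSeg x n := (initSeg_eq_iff _ _ _).2 hy
  simpa [this] using hx

/-- The perfect tree theorem. -/
theorem exists_perfect_subtree (T : Descriptive.tree ℕ) (hT : ¬ (body T).Countable) :
    ∃ T' : Descriptive.tree ℕ, T' ≤ T ∧ IsPerfectTree T' := by
  obtain ⟨D, hD, ⟨x₀, hx₀⟩, hDT⟩ :=
    exists_perfect_nonempty_of_isClosed_of_not_countable (isClosed_body T) hT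
  refine ⟨⟨{v | ∃ x ∈ D, ∃ n, v = initSeg x n}, ?_⟩, ?_, ⟨[], x₀, hx₀, 0, rfl⟩, ?_⟩
  · rintro v a ⟨x, hx, n, hn⟩
    refine ⟨x, hx, v.length, ?_⟩
    have hlen : n = v.length + 1 := by
      have := congrArg List.length hn
      simp [initSeg_length] at this
      omega
    subst hlen
    have : v ++ [a] = initSeg x v.length ++ [x v.length] := by
      rw [hn]
      simp [initSeg, List.range_succ]
    exact (List.append_inj this (by rw [initSeg_length])).1
  · rintro v ⟨x, hx, n, rfl⟩
    exact hDT hx n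
  · rintro v ⟨x, hx, n, rfl⟩
    obtain ⟨y, ⟨hyc, hyD⟩, hyx⟩ := preperfect_iff_nhds.1 hD.acc x hx (PiNat.cylinder x n)
      ((PiNat.isOpen_cylinder _ _ _).mem_nhds (PiNat.self_mem_cylinder _ _))
    obtain ⟨i, hi⟩ := Function.ne_iff.1 hyx
    have hxy : initSeg x n = initSeg y n := ((initSeg_eq_iff _ _ _).2 hyc).symm
    set m := max n (i + 1) with hm
    have hne : initSeg x m ≠ initSeg y m := fun h =>
      hi ((initSeg_eq_iff _ _ _).1 h i (by omega)).symm
    refine ⟨initSeg x m, ⟨x, hx, m, rfl⟩, initSeg y m, ⟨y, hyD, m, rfl⟩,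
      initSeg_prefix x (le_max_left _ _), ?_, ?_, ?_⟩
    · rw [hxy]
      exact initSeg_prefix y (le_max_left _ _)
    · exact fun h => hne (h.eq_of_length (by simp [initSeg_length]))
    · exact fun h => hne (h.eq_of_length (by simp [initSeg_length])).symm

/-- The one-sided perfect tree theorem `PTT₁`: given a tree with uncountably many paths, find a
perfect subtree. -/
def PTT₁ : MultiFun treeSpace treeSpace where
  dom := {T : Descriptive.tree ℕ | ¬ (body T).Countable}
  val T := {T' : Descriptive.tree ℕ | T' ≤ (show Descriptive.tree ℕ from T) ∧ IsPerfectTree T'}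
  nonempty T hT := exists_perfect_subtree T hT

end Weihrauch

/-! The problems are in fact strongly equivalent. For `PTT₁ ≤ C`, decorate a perfect subtree `T'`
of `T` by attaching to each node two incomparable extensions in `T'`: being a decorated perfect
subtree of `T` is then a closed condition, with negative information computable from `T`. For
`C ≤ PTT₁`, a name of a nonempty closed set `A` computes a tree whose paths are the points of
`A × ℕ^ℕ`. There are uncountably many of them, and from a perfect subtree, having no dead ends, one
computes a path, hence a point of `A`. -/

namespace Weihrauch

open Encodable Denumerable

/-! ### Word functions -/

section Words

variable {φ : List ℕ → List ℕ} {p y : Baire}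

theorem getD_initSeg (p : Baire) (d : ℕ) {n k : ℕ} (h : k < n) : (initSeg p n).getD k d = p k := by
  simp [initSeg, List.getD, h]

theorem getElem_initSeg (p : Baire) {n i : ℕ} (h : i < (initSeg p n).length) :
    (initSeg p n)[i] = p i := by
  simp [initSeg]

theorem map_initSeg (f : ℕ → ℕ) (p : Baire) (n : ℕ) :
    (initSeg p n).map f = initSeg (fun k => f (p k)) n := by
  simp [initSeg, Function.comp_def]

theorem take_initSeg (p : Baire) (m n : ℕ) : (initSeg p n).take m = initSeg p (min m n) := by
  simp [initSeg, ← List.map_take, List.take_range]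

theorem eq_initSeg_of_prefix {u : List ℕ} {n : ℕ} (h : u <+: initSeg p n) :
    u = initSeg p u.length := by
  have hle : u.length ≤ n := by simpa only [initSeg_length] using h.length_le
  rw [List.prefix_iff_eq_take.1 h, take_initSeg, min_eq_left hle, initSeg_length]

theorem Produces.map (f : ℕ → ℕ) (h : Produces φ p y) :
    Produces (fun σ => (φ σ).map f) p fun k => f (y k) := by
  refine ⟨fun n => ?_, fun k => ?_⟩
  · simp only [List.length_map]
    exact (congrArg (List.map f) (h.1 n)).trans (map_initSeg f y _)
  · simpa only [List.length_map] using h.2 k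

theorem exists_produces_of_chain (hmono : ∀ n, φ (initSeg p n) <+: φ (initSeg p (n + 1)))
    (hlen : ∀ k, ∃ n, k ≤ (φ (initSeg p n)).length) : ∃ y, Produces φ p y := by
  have hle : ∀ {m n}, m ≤ n → φ (initSeg p m) <+: φ (initSeg p n) := fun {m n} h =>
    Nat.le_induction (List.prefix_refl _) (fun n _ ih => ih.trans (hmono n)) n h
  choose N hN using hlen
  refine ⟨fun k => (φ (initSeg p (N (k + 1)))).getD k 0, fun n => ?_, fun k => ⟨N k, hN k⟩⟩
  refine List.ext_getElem (initSeg_length _ _).symm fun i hi _ => ?_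
  have hi' : i < (φ (initSeg p (N (i + 1)))).length := hN (i + 1)
  have hagree : (φ (initSeg p n))[i] = (φ (initSeg p (N (i + 1))))[i] := by
    rcases le_total n (N (i + 1)) with h | h
    · exact (hle h).getElem hi
    · exact ((hle h).getElem hi').symm
  rw [getElem_initSeg, hagree, List.getD_eq_getElem _ _ hi']

theorem isContinuous_limitFun (φ : List ℕ → List ℕ) : IsContinuous (limitFun φ) := by
  have hprod : ∀ p : (limitFun φ).Dom, Produces φ p.1 ((limitFun φ).fn p.1 p.2) :=
    fun p => mem_limitFun.1 ⟨p.2, rfl⟩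
  refine continuous_pi fun i => continuous_iff_continuousAt.2 fun p => ?_
  obtain ⟨n, hn⟩ := (hprod p).2 (i + 1)
  have hnhds : Subtype.val ⁻¹' PiNat.cylinder p.1 n ∈ nhds p :=
    continuous_subtype_val.continuousAt.preimage_mem_nhds
      ((PiNat.isOpen_cylinder (fun _ => ℕ) _ n).mem_nhds (PiNat.self_mem_cylinder _ _))
  refine ContinuousAt.congr (f := fun _ => (limitFun φ).fn p.1 p.2 i) continuousAt_const ?_
  filter_upwards [hnhds] with p' hp'
  have hsame : initSeg p'.1 n = initSeg p.1 n := (initSeg_eq_iff _ _ _).2 hp'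
  have hword := (hprod p').1 n
  rw [hsame] at hword
  exact (initSeg_eq_iff _ _ _).1 (((hprod p).1 n).symm.trans hword) i hn

/-- The word function of the map on Baire space whose value at `p` has the `j`-th entry
`g j (p ↾ (j + 1))`. -/
def entrywise (g : ℕ → List ℕ → ℕ) (σ : List ℕ) : List ℕ :=
  (List.range σ.length).map fun j => g j (σ.take (j + 1))

theorem produces_entrywise (g : ℕ → List ℕ → ℕ) (p : Baire) :
    Produces (entrywise g) p fun j => g j (initSeg p (j + 1)) := by
  have hlen : ∀ n, (entrywise g (initSeg p n)).length = n := fun n => by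
    simp [entrywise, initSeg_length]
  refine ⟨fun n => ?_, fun k => ⟨k, (hlen k).ge⟩⟩
  rw [hlen, entrywise, initSeg_length]
  refine List.map_congr_left fun j hj => ?_
  rw [take_initSeg, min_eq_left (List.mem_range.1 hj)]

end Words

/-! ### Computability -/

section Computability

variable {α β : Type} [Primcodable α] [Primcodable β]

theorem computable_map_range {f : α → ℕ → β} {n : α → ℕ} (hn : Computable n)
    (hf : Computable₂ f) : Computable fun a => (List.range (n a)).map (f a) := by
  have hstep : Computable₂ fun (a : α) (t : ℕ × List β) => t.2 ++ [f a t.1] :=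
    Computable.list_concat.comp (Computable.snd.comp Computable.snd)
      (hf.comp Computable.fst (Computable.fst.comp Computable.snd))
  refine (Computable.nat_rec hn (Computable.const []) hstep).of_eq fun a => ?_
  induction n a with
  | zero => rfl
  | succ n ih => simp only [ih, List.range_succ, List.map_append, List.map_singleton]

theorem computable_entrywise {g : α → ℕ → List ℕ → ℕ} {σ : α → List ℕ}
    (hg : Computable fun t : α × ℕ × List ℕ => g t.1 t.2.1 t.2.2) (hσ : Computable σ) :
    Computable fun a => entrywise (g a) (σ a) :=
  computable_map_range (Computable.list_length.comp hσ) <|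
    hg.comp (Computable.fst.pair (Computable.snd.pair (Primrec.list_take.to_comp.comp
      (Computable.succ.comp Computable.snd) (hσ.comp Computable.fst))))

theorem computable_encode_entrywise_ofNat {g : List ℕ → ℕ → List ℕ → ℕ}
    (hg : Computable fun t : List ℕ × ℕ × List ℕ => g t.1 t.2.1 t.2.2) :
    Computable₂ fun (j : ℕ) (σ : List ℕ) => encode (entrywise (g σ) (ofNat (List ℕ) j)) := by
  have hσ : Computable fun t : (ℕ × List ℕ) × ℕ × List ℕ => g t.1.2 t.2.1 t.2.2 :=
    hg.comp ((Computable.snd.comp Computable.fst).pair Computable.snd)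
  have hword : Computable fun t : ℕ × List ℕ => entrywise (g t.2) (ofNat (List ℕ) t.1) :=
    computable_entrywise (g := fun t => g t.2) hσ
      ((Computable.ofNat (List ℕ)).comp Computable.fst)
  exact Computable.encode.comp hword

theorem computable_ite {P : α → Prop} [DecidablePred P] {f g : α → β} (hP : ComputablePred P)
    (hf : Computable f) (hg : Computable g) : Computable fun a => if P a then f a else g a := by
  simpa only [Bool.cond_decide] using hP.decide.cond hf hg

theorem isComputable_of_entries {F : Baire → Baire} {g : ℕ → List ℕ → ℕ} (hg : Computable₂ g)
    (h : ∀ p j, F p j = g j (initSeg p (j + 1))) : IsComputable (F : Baire →. Baire) := by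
  refine ⟨entrywise g, computable_entrywise (Computable.comp hg Computable.snd) Computable.id, ?_⟩
  rintro p y hy
  obtain rfl : y = F p := Part.mem_some_iff.1 hy
  rw [mem_limitFun, show F p = _ from funext (h p)]
  exact produces_entrywise g p

theorem primrecPred_imp {P Q : α → Prop} (hP : PrimrecPred P) (hQ : PrimrecPred Q) :
    PrimrecPred fun a => P a → Q a :=
  (hP.not.or hQ).of_eq fun _ => imp_iff_not_or.symm

theorem primrecPred_forall_lt {P : α → ℕ → Prop} {n : α → ℕ} (hn : Primrec n)
    (hP : PrimrecRel P) : PrimrecPred fun a => ∀ k < n a, P a k := by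
  have hswap : PrimrecRel fun k a => P a k := PrimrecPred.comp hP (Primrec.snd.pair Primrec.fst)
  exact (hswap.forall_mem_list.comp (Primrec.list_range.comp hn) Primrec.id).of_eq
    fun a => by simp only [List.mem_range, id]

theorem primrecRel_isPrefix : PrimrecRel fun u v : List ℕ => u <+: v :=
  (Primrec.eq.comp Primrec.fst
    (Primrec.list_take.comp (Primrec.list_length.comp Primrec.fst) Primrec.snd)).of_eq
    fun _ => List.prefix_iff_eq_take.symm

end Computability

/-! ### Strong Weihrauch reducibility -/

section StrongReducibility

variable {X Y Z W : RepSpace} {f : MultiFun X Y} {g : MultiFun Z W}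

/-- Strong Weihrauch reducibility: unlike in `WeihrauchReducible`, the outer function `K` sees only
the answer to the query and not the original input. -/
def StrongWeihrauchReducible (f : MultiFun X Y) (g : MultiFun Z W) : Prop :=
  ∃ K H : Baire →. Baire, IsComputable K ∧ IsComputable H ∧
    ∀ G : Baire →. Baire, Realizes G g →
      Realizes (fun p => (H p).bind fun r => (G r).bind K) f

/-- The second projection for the pairing `⟨p, q⟩` of Baire space. -/
def unpairRight (r : Baire) : Baire := fun k => r (2 * k + 1)

theorem unpairRight_pair (p q : Baire) : unpairRight (pair p q) = q := by
  funext k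
  have hodd : (2 * k + 1) % 2 ≠ 0 := by omega
  have hhalf : (2 * k + 1) / 2 = k := by omega
  simp only [unpairRight, pair, if_neg hodd, hhalf]

theorem IsComputable.comp_unpairRight {K : Baire →. Baire} (hK : IsComputable K) :
    IsComputable fun r => K (unpairRight r) := by
  obtain ⟨φ, hφ, hKφ⟩ := hK
  let odd : List ℕ → List ℕ := fun σ =>
    (List.range (σ.length / 2)).map fun k => σ.getD (2 * k + 1) 0
  have hodd : Primrec odd := Primrec.list_map
    (Primrec.list_range.comp (Primrec.nat_div.comp Primrec.list_length (Primrec.const 2)))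
    ((Primrec.list_getD 0).comp Primrec.fst
      (Primrec.succ.comp (Primrec.nat_mul.comp (Primrec.const 2) Primrec.snd)))
  have hseg : ∀ r n, odd (initSeg r n) = initSeg (unpairRight r) (n / 2) := fun r n => by
    simp only [odd, initSeg_length]
    refine List.map_congr_left fun k hk => getD_initSeg _ _ ?_
    have := List.mem_range.1 hk
    omega
  refine ⟨fun σ => φ (odd σ), hφ.comp hodd.to_comp, fun r y hy => mem_limitFun.2 ?_⟩
  have hprod := mem_limitFun.1 (hKφ _ y hy)
  refine ⟨fun n => ?_, fun k => ?_⟩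
  · simpa only [hseg] using hprod.1 (n / 2)
  · obtain ⟨n, hn⟩ := hprod.2 k
    refine ⟨2 * n, ?_⟩
    simpa only [hseg, Nat.mul_div_cancel_left n two_pos] using hn

theorem StrongWeihrauchReducible.weihrauchReducible (h : StrongWeihrauchReducible f g) :
    WeihrauchReducible f g := by
  obtain ⟨K, H, hK, hH, hKH⟩ := h
  refine ⟨fun r => K (unpairRight r), H, hK.comp_unpairRight, hH, fun G hG => ?_⟩
  simpa only [unpairRight_pair] using hKH G hG

theorem strongWeihrauchReducible_of_transfer {K H : Baire →. Baire} (hK : IsComputable K)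
    (hH : IsComputable H)
    (h : ∀ p x, X.IsName p x → x ∈ f.dom → ∃ r ∈ H p, ∃ x' ∈ g.dom, Z.IsName r x' ∧
      ∀ s, ∀ y' ∈ g.val x', W.IsName s y' → ∃ q ∈ K s, ∃ y ∈ f.val x, Y.IsName q y) :
    StrongWeihrauchReducible f g := by
  refine ⟨K, H, hK, hH, fun G hG p x hp hx => ?_⟩
  obtain ⟨r, hr, x', hx', hrx', hback⟩ := h p x hp hx
  obtain ⟨s, hs, y', hy', hsy'⟩ := hG r x' hrx' hx'
  obtain ⟨q, hq, hqy⟩ := hback s y' hy' hsy'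
  exact ⟨q, Part.mem_bind hr (Part.mem_bind hs hq), hqy⟩

end StrongReducibility

/-! ### Names of closed sets -/

section ClosedSets

variable {X Y : RepSpace}

theorem exists_isName_closedSets {q : Baire} {A : Set X.carrier}
    (h : Realizes (limitFun (wordFun q)) (MultiFun.ofFun (Y := sierpinski) fun x => x ∉ A)) :
    ∃ hA, (closedSets X).IsName q ⟨A, hA⟩ := by
  let χ : (functionSpace X sierpinski).carrier := ⟨fun x => x ∉ A, _, isContinuous_limitFun _, h⟩
  let U : (openSets X).carrier := ⟨Aᶜ, χ, fun _ => Iff.rfl⟩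
  exact ⟨⟨U, rfl⟩, U, rfl, χ, fun _ => Iff.rfl, h⟩

theorem realizes_of_isName_closedSets {q : Baire} {A : (closedSets X).carrier}
    (h : (closedSets X).IsName q A) :
    Realizes (limitFun (wordFun q)) (MultiFun.ofFun (Y := sierpinski) fun x => x ∉ A.1) := by
  obtain ⟨U, hU, χ, hχ, hq⟩ := h
  have hχA : χ.1 = fun x => x ∉ A.1 := funext fun x => propext ((hχ x).trans (by rw [hU]; rfl))
  exact hχA ▸ hq

/-- The closed set of the points all of whose initial segments satisfy the relation `R` together
with the corresponding initial segment of the parameter `p`. For computable `R` these are the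
`Π⁰₁` classes relative to `p`. -/
def closedSetOf (R : List ℕ → List ℕ → Prop) (p : Baire) : Set Baire :=
  {z | ∀ n, R (initSeg z n) (initSeg p n)}

open Classical in
/-- The negative information on `closedSetOf R p`: the `i`-th entry of the answer at `z` is `0` or
`1` according to whether `R` holds at stage `i`. -/
noncomputable def closedSetName (R : List ℕ → List ℕ → Prop) (p : Baire) : Baire := fun j =>
  encode (entrywise (fun i w => if R (w.take i) (initSeg p i) then 0 else 1) (ofNat (List ℕ) j))

theorem exists_isName_closedSetName (R : List ℕ → List ℕ → Prop) (p : Baire) :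
    ∃ hA, (closedSets baireSpace).IsName (closedSetName R p) ⟨closedSetOf R p, hA⟩ := by
  classical
  refine exists_isName_closedSets ?_
  rintro z _ rfl -
  have hword : wordFun (closedSetName R p) =
      entrywise fun i w => if R (w.take i) (initSeg p i) then 0 else 1 := by
    funext w
    simp [wordFun, closedSetName]
  refine ⟨_, mem_limitFun.2 (hword ▸ produces_entrywise _ z), _, rfl, ?_⟩
  change z ∉ closedSetOf R p ↔ _
  simp [closedSetOf, take_initSeg]

theorem isComputable_closedSetName {R : List ℕ → List ℕ → Prop}
    (hR : ComputablePred fun t : List ℕ × List ℕ => R t.1 t.2) :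
    IsComputable (closedSetName R : Baire →. Baire) := by
  classical
  let χ : List ℕ → ℕ → List ℕ → ℕ := fun σ i w => if R (w.take i) (σ.take i) then 0 else 1
  have hχ : Computable fun t : List ℕ × ℕ × List ℕ => χ t.1 t.2.1 t.2.2 := by
    have hi : Computable fun t : List ℕ × ℕ × List ℕ => t.2.1 :=
      Computable.fst.comp Computable.snd
    have hσ : Computable fun t : List ℕ × ℕ × List ℕ => t.1.take t.2.1 :=
      Primrec.list_take.to_comp.comp hi Computable.fst
    have hw : Computable fun t : List ℕ × ℕ × List ℕ => t.2.2.take t.2.1 :=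
      Primrec.list_take.to_comp.comp hi (Computable.snd.comp Computable.snd)
    have hdec := hR.decide.comp (hw.pair hσ)
    exact computable_ite hdec.computablePred (Computable.const 0) (Computable.const 1)
  refine isComputable_of_entries (computable_encode_entrywise_ofNat hχ) fun p j => ?_
  have hlen : (ofNat (List ℕ) j).length ≤ j := by
    simpa only [encode_ofNat] using length_le_encode (ofNat (List ℕ) j)
  refine congrArg encode (List.map_congr_left fun i hi => ?_)
  have hi' : i ≤ j + 1 := by have := List.mem_range.1 hi; omega
  simp only [χ, take_initSeg, min_eq_left hi']

theorem strongWeihrauchReducible_closedChoice {f : MultiFun X Y} {R : List ℕ → List ℕ → Prop}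
    (hR : ComputablePred fun t : List ℕ × List ℕ => R t.1 t.2) {K : Baire →. Baire}
    (hK : IsComputable K)
    (h : ∀ p x, X.IsName p x → x ∈ f.dom → (closedSetOf R p).Nonempty ∧
      ∀ z ∈ closedSetOf R p, ∃ q ∈ K z, ∃ y ∈ f.val x, Y.IsName q y) :
    StrongWeihrauchReducible f (closedChoice baireSpace) := by
  refine strongWeihrauchReducible_of_transfer hK (isComputable_closedSetName hR) fun p x hp hx => ?_
  obtain ⟨hne, hsol⟩ := h p x hp hx
  obtain ⟨hA, hname⟩ := exists_isName_closedSetName R p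
  refine ⟨_, Part.mem_some _, ⟨closedSetOf R p, hA⟩, hne, hname, ?_⟩
  rintro s _ hz rfl
  exact hsol s hz

end ClosedSets

/-! ### Trees -/

section Trees

variable {T : Descriptive.tree ℕ}

/-- The set of words whose codes have nonzero entries in `p`; for a name `p` of a tree this is the
tree. -/
def nodes (p : Baire) : Set (List ℕ) := {v | p (encode v) ≠ 0}

theorem nodes_eq_of_isName {p : Baire} (hp : treeSpace.IsName p T) : nodes p = T := by
  ext v
  refine ⟨fun hv => by_contra fun hT => hv ((hp v).2 hT), fun hT => ?_⟩
  exact ((hp v).1 hT).trans_ne one_ne_zero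

open Classical in
theorem isName_treeSpace {p : Baire} (h : ∀ v, p (encode v) = if v ∈ T then 1 else 0) :
    treeSpace.IsName p T := fun v =>
  ⟨fun hv : v ∈ T => (h v).trans (if_pos hv), fun hv : v ∉ T => (h v).trans (if_neg hv)⟩

/-- A nonempty tree without dead ends. -/
def IsPruned (T : Descriptive.tree ℕ) : Prop :=
  [] ∈ T ∧ ∀ v ∈ T, ∃ w ∈ T, v <+: w ∧ v.length < w.length

theorem IsPerfectTree.isPruned (hT : IsPerfectTree T) : IsPruned T := by
  obtain ⟨⟨v, hv⟩, hsplit⟩ := hT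
  refine ⟨Descriptive.Tree.mem_of_prefix v.nil_prefix hv, fun v hv => ?_⟩
  obtain ⟨u, hu, w, -, hvu, hvw, huw, -⟩ := hsplit v hv
  refine ⟨u, hu, hvu, lt_of_not_ge fun hle => huw ?_⟩
  rwa [← hvu.eq_of_length_le hle]

theorem IsPruned.exists_le_length (hT : IsPruned T) {v : List ℕ} (hv : v ∈ T) (k : ℕ) :
    ∃ w ∈ T, v <+: w ∧ k ≤ w.length := by
  induction k with
  | zero => exact ⟨v, hv, List.prefix_refl _, Nat.zero_le _⟩
  | succ k ih =>
    obtain ⟨w, hw, hvw, hk⟩ := ih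
    obtain ⟨w', hw', hww', hlt⟩ := hT.2 w hw
    exact ⟨w', hw', hvw.trans hww', by omega⟩

end Trees

/-! ### Decorated perfect subtrees -/

section PerfectSubtrees

/-- `u` and `w` are incomparable extensions of `v`. -/
def Splits (v u w : List ℕ) : Prop := v <+: u ∧ v <+: w ∧ ¬ u <+: w ∧ ¬ w <+: u

/-- The closure conditions on a node `v` of a subtree `S` of `T` to which the pair `c` of words is
attached. -/
def IsSplitNode (T S : Set (List ℕ)) (v : List ℕ) (c : List ℕ × List ℕ) : Prop :=
  v ∈ T ∧ v.dropLast ∈ S ∧ c.1 ∈ S ∧ c.2 ∈ S ∧ Splits v c.1 c.2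

/-- The pair of words attached to a node by a nonzero entry `a`; the entry `0` is reserved for the
words outside the tree. -/
def decoration (a : ℕ) : List ℕ × List ℕ := ofNat (List ℕ × List ℕ) a.pred

/-- `z` codes a perfect subtree of the tree named by `p`, each node of the subtree being decorated
by two incomparable extensions. -/
def CodesPerfectSubtree (z p : Baire) : Prop :=
  [] ∈ nodes z ∧ ∀ v ∈ nodes z, IsSplitNode (nodes p) (nodes z) v (decoration (z (encode v)))

/-- The words that can still be nodes of the set coded by an extension of `σ`. -/
def possibleNodes (σ : List ℕ) : Set (List ℕ) := {v | σ.getD (encode v) 1 ≠ 0}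

/-- The finite information `w`, `σ` on `z`, `p` does not refute `CodesPerfectSubtree z p`. -/
def MayCodePerfectSubtree (w σ : List ℕ) : Prop :=
  [] ∈ possibleNodes w ∧ ∀ k < w.length, w.getD k 0 ≠ 0 →
    IsSplitNode (possibleNodes σ) (possibleNodes w) (ofNat (List ℕ) k) (decoration (w.getD k 0))

variable {p z : Baire}

theorem mem_possibleNodes_initSeg {v : List ℕ} {n : ℕ} (h : encode v < n) :
    v ∈ possibleNodes (initSeg p n) ↔ v ∈ nodes p := by
  simp only [possibleNodes, nodes, Set.mem_ofPred_eq, getD_initSeg p 1 h]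

theorem nodes_subset_possibleNodes (p : Baire) (n : ℕ) :
    nodes p ⊆ possibleNodes (initSeg p n) := by
  intro v hv
  rcases lt_or_ge (encode v) n with h | h
  · exact (mem_possibleNodes_initSeg h).2 hv
  · simp [possibleNodes, initSeg_length, h]

theorem IsSplitNode.mono {T T' S S' : Set (List ℕ)} {v : List ℕ} {c : List ℕ × List ℕ}
    (hT : T ⊆ T') (hS : S ⊆ S') (h : IsSplitNode T S v c) : IsSplitNode T' S' v c :=
  ⟨hT h.1, hS h.2.1, hS h.2.2.1, hS h.2.2.2.1, h.2.2.2.2⟩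

theorem mem_closedSetOf_mayCodePerfectSubtree :
    z ∈ closedSetOf MayCodePerfectSubtree p ↔ CodesPerfectSubtree z p := by
  refine ⟨fun h => ⟨(mem_possibleNodes_initSeg (v := []) one_pos).1 (h 1).1, fun v hv => ?_⟩,
    fun h n => ⟨nodes_subset_possibleNodes z n h.1, fun k hk hzk => ?_⟩⟩
  · set c := decoration (z (encode v))
    let n := encode v + encode v.dropLast + encode c.1 + encode c.2 + 1
    have hvn : encode v < n := by omega
    have hsplit := (h n).2 (encode v) (by rwa [initSeg_length])
    rw [getD_initSeg z 0 hvn, ofNat_encode] at hsplit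
    obtain ⟨hvT, hparent, hleft, hright, hvc⟩ := hsplit hv
    exact ⟨(mem_possibleNodes_initSeg hvn).1 hvT,
      (mem_possibleNodes_initSeg (by omega)).1 hparent,
      (mem_possibleNodes_initSeg (by omega)).1 hleft,
      (mem_possibleNodes_initSeg (by omega)).1 hright, hvc⟩
  · rw [initSeg_length] at hk
    rw [getD_initSeg z 0 hk] at hzk ⊢
    have hsplit := h.2 (ofNat (List ℕ) k) (by rwa [nodes, Set.mem_ofPred_eq, encode_ofNat])
    rw [encode_ofNat] at hsplit
    exact hsplit.mono (nodes_subset_possibleNodes p n) (nodes_subset_possibleNodes z n)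

theorem CodesPerfectSubtree.exists_tree (h : CodesPerfectSubtree z p) :
    ∃ T : Descriptive.tree ℕ, T = nodes z ∧ nodes z ⊆ nodes p ∧ IsPerfectTree T := by
  have hparent : ∀ ⦃v : List ℕ⦄ ⦃a : ℕ⦄, v ++ [a] ∈ nodes z → v ∈ nodes z := fun v a hv => by
    simpa only [List.dropLast_concat] using (h.2 _ hv).2.1
  refine ⟨⟨nodes z, hparent⟩, rfl, fun v hv => (h.2 v hv).1, ⟨[], h.1⟩, fun v hv => ?_⟩
  obtain ⟨-, -, hleft, hright, hsplits⟩ := h.2 v hv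
  exact ⟨_, hleft, _, hright, hsplits⟩

theorem exists_codesPerfectSubtree {T : Descriptive.tree ℕ} (hT : IsPerfectTree T)
    (hle : (T : Set (List ℕ)) ⊆ nodes p) : ∃ z, CodesPerfectSubtree z p := by
  classical
  have hnil := hT.isPruned.1
  obtain ⟨-, hsplit⟩ := hT
  choose! u hu w hw huw using hsplit
  let z : Baire := fun k =>
    if ofNat (List ℕ) k ∈ T then encode (u (ofNat (List ℕ) k), w (ofNat (List ℕ) k)) + 1 else 0
  have hz : ∀ v, z (encode v) = if v ∈ T then encode (u v, w v) + 1 else 0 := fun v => by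
    simp only [z, ofNat_encode]
  have hnodes : nodes z = T := by
    ext v
    simp [nodes, hz]
  refine ⟨z, hnodes ▸ hnil, fun v hv => ?_⟩
  rw [hnodes] at hv ⊢
  have hvT : v ∈ T := hv
  have hdec : decoration (z (encode v)) = (u v, w v) := by
    rw [hz, if_pos hvT, decoration, Nat.pred_succ, ofNat_encode]
  rw [hdec]
  exact ⟨hle hv, Descriptive.Tree.mem_of_prefix v.dropLast_prefix hvT, hu v hvT, hw v hvT,
    huw v hvT⟩

end PerfectSubtrees

section PerfectSubtreesComputability

variable {α : Type} [Primcodable α]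

theorem primrecPred_mem_possibleNodes {σ v : α → List ℕ} (hσ : Primrec σ) (hv : Primrec v) :
    PrimrecPred fun a => v a ∈ possibleNodes (σ a) :=
  (Primrec.eq.comp ((Primrec.list_getD 1).comp hσ (Primrec.encode.comp hv)) (Primrec.const 0)).not

theorem primrecPred_splits {v u w : α → List ℕ} (hv : Primrec v) (hu : Primrec u)
    (hw : Primrec w) : PrimrecPred fun a => Splits (v a) (u a) (w a) :=
  (primrecRel_isPrefix.comp hv hu).and ((primrecRel_isPrefix.comp hv hw).and
    ((primrecRel_isPrefix.comp hu hw).not.and (primrecRel_isPrefix.comp hw hu).not))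

theorem primrecPred_isSplitNode {σ w v : α → List ℕ} {c : α → List ℕ × List ℕ} (hσ : Primrec σ)
    (hw : Primrec w) (hv : Primrec v) (hc : Primrec c) :
    PrimrecPred fun a => IsSplitNode (possibleNodes (σ a)) (possibleNodes (w a)) (v a) (c a) := by
  have hdropLast : Primrec fun a => (v a).dropLast :=
    (Primrec.list_take.comp (Primrec.pred.comp (Primrec.list_length.comp hv)) hv).of_eq
      fun _ => List.dropLast_eq_take.symm
  exact (primrecPred_mem_possibleNodes hσ hv).and
    ((primrecPred_mem_possibleNodes hw hdropLast).and
      ((primrecPred_mem_possibleNodes hw (Primrec.fst.comp hc)).and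
        ((primrecPred_mem_possibleNodes hw (Primrec.snd.comp hc)).and
          (primrecPred_splits hv (Primrec.fst.comp hc) (Primrec.snd.comp hc)))))

theorem primrecPred_mayCodePerfectSubtree :
    PrimrecPred fun t : List ℕ × List ℕ => MayCodePerfectSubtree t.1 t.2 := by
  have hw : Primrec fun t : (List ℕ × List ℕ) × ℕ => t.1.1 := Primrec.fst.comp Primrec.fst
  have hentry : Primrec fun t : (List ℕ × List ℕ) × ℕ => t.1.1.getD t.2 0 :=
    (Primrec.list_getD 0).comp hw Primrec.snd
  have hdec : Primrec decoration := (Primrec.ofNat (List ℕ × List ℕ)).comp Primrec.pred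
  refine (primrecPred_mem_possibleNodes Primrec.fst (Primrec.const [])).and
    (primrecPred_forall_lt (Primrec.list_length.comp Primrec.fst) ?_)
  exact primrecPred_imp (Primrec.eq.comp hentry (Primrec.const 0)).not
    (primrecPred_isSplitNode (Primrec.snd.comp Primrec.fst) hw
      ((Primrec.ofNat (List ℕ)).comp Primrec.snd) (hdec.comp hentry))

end PerfectSubtreesComputability

theorem PTT₁_strongWeihrauchReducible_closedChoice :
    StrongWeihrauchReducible PTT₁ (closedChoice baireSpace) := by
  let K : Baire → Baire := fun z k => if z k = 0 then 0 else 1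
  have hK : IsComputable (K : Baire →. Baire) :=
    isComputable_of_entries (g := fun k σ => if σ.getD k 0 = 0 then 0 else 1)
      (Primrec.ite (Primrec.eq.comp ((Primrec.list_getD 0).comp Primrec.snd Primrec.fst)
        (Primrec.const 0)) (Primrec.const 0) (Primrec.const 1)).to_comp
      fun z k => by rw [getD_initSeg z 0 k.lt_succ_self]
  refine strongWeihrauchReducible_closedChoice
    primrecPred_mayCodePerfectSubtree.computablePred hK fun p T hp hT => ⟨?_, fun z hz => ?_⟩
  · obtain ⟨T', hle, hT'⟩ := exists_perfect_subtree T hT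
    have hsub : (T' : Set (List ℕ)) ⊆ nodes p := by rwa [nodes_eq_of_isName hp]
    obtain ⟨z, hz⟩ := exists_codesPerfectSubtree hT' hsub
    exact ⟨z, mem_closedSetOf_mayCodePerfectSubtree.2 hz⟩
  · obtain ⟨T', hT'z, hzp, hT'⟩ := (mem_closedSetOf_mayCodePerfectSubtree.1 hz).exists_tree
    have hle : (T' : Set (List ℕ)) ⊆ _ := hT'z.le.trans (hzp.trans (nodes_eq_of_isName hp).le)
    refine ⟨K z, Part.mem_some _, T', ⟨hle, hT'⟩, isName_treeSpace fun v => ?_⟩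
    have hv : v ∈ T' ↔ z (encode v) ≠ 0 := Set.ext_iff.1 hT'z v
    simp only [K, hv, ite_not]

/-! ### Closed sets as bodies of trees -/

section Unrefuted

variable {q : Baire}

/-- No entry of `q` with an index below the length of `w` provides a nonzero output of the word
function coded by `q` on a prefix of `w`. The bound on the indices makes this condition depend only
on finitely many entries of `q`. -/
def Unrefuted (q : Baire) (w : List ℕ) : Prop :=
  ∀ u, u <+: w → encode u < w.length → ∀ a ∈ wordFun q u, a = 0

/-- The tree of the words that are not refuted by `q`. -/
def unrefutedTree (q : Baire) : Descriptive.tree ℕ :=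
  ⟨{w | Unrefuted q w}, fun w a hw u hu hlt =>
    hw u (hu.trans (List.prefix_append w [a])) (hlt.trans_le (by simp))⟩

theorem body_unrefutedTree {A : (closedSets baireSpace).carrier}
    (h : (closedSets baireSpace).IsName q A) : body (unrefutedTree q) = A.1 := by
  ext x
  obtain ⟨r, hr, _, rfl, hrA⟩ := realizes_of_isName_closedSets h x x rfl trivial
  replace hr : Produces (wordFun q) x r := mem_limitFun.1 hr
  replace hrA : x ∉ A.1 ↔ ∃ n, r n ≠ 0 := hrA
  refine ⟨fun hx => by_contra fun hxA => ?_, fun hxA n u hu _ a ha => by_contra fun ha0 => ?_⟩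
  · obtain ⟨n, hn⟩ := hrA.1 hxA
    obtain ⟨m, hm⟩ := hr.2 (n + 1)
    refine hn (hx (max m (encode (initSeg x m) + 1)) (initSeg x m)
      (initSeg_prefix x (le_max_left _ _)) (by simp [initSeg_length]) _ ?_)
    rw [hr.1 m]
    exact List.mem_map.2 ⟨n, List.mem_range.2 hm, rfl⟩
  · rw [eq_initSeg_of_prefix hu, hr.1] at ha
    obtain ⟨i, -, rfl⟩ := List.mem_map.1 ha
    exact hrA.2 ⟨i, ha0⟩ hxA

theorem unrefuted_congr {q' : Baire} {w : List ℕ} (h : ∀ k < w.length, q k = q' k) :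
    Unrefuted q w ↔ Unrefuted q' w :=
  forall_congr' fun u => imp_congr_right fun _ => forall_congr' fun hu => by
    rw [wordFun, wordFun, h _ hu]

theorem primrecPred_unrefuted :
    PrimrecPred fun t : List ℕ × List ℕ => Unrefuted (fun k => t.1.getD k 0) t.2 := by
  have hof := Primrec.ofNat (List ℕ)
  have hzero : PrimrecPred fun l : List ℕ => ∀ a ∈ l, a = 0 :=
    PrimrecPred.forall_mem_list (Primrec.eq.comp Primrec.id (Primrec.const 0))
  have hcodes : PrimrecPred fun t : List ℕ × List ℕ => ∀ k < t.2.length,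
      ofNat (List ℕ) k <+: t.2 → ∀ a ∈ ofNat (List ℕ) (t.1.getD k 0), a = 0 :=
    primrecPred_forall_lt (Primrec.list_length.comp Primrec.snd) <| primrecPred_imp
      (primrecRel_isPrefix.comp (hof.comp Primrec.snd) (Primrec.snd.comp Primrec.fst))
      (hzero.comp (hof.comp ((Primrec.list_getD 0).comp (Primrec.fst.comp Primrec.fst)
        Primrec.snd)))
  refine hcodes.of_eq fun t => ⟨fun h u hu hlt => ?_, fun h k hk hkt => ?_⟩
  · exact h (encode u) hlt (by rwa [ofNat_encode])
  · simpa only [wordFun, encode_ofNat] using h _ hkt (by rwa [encode_ofNat])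

end Unrefuted

/-! ### Adding a free coordinate -/

section Product

variable {T : Descriptive.tree ℕ}

/-- The word of the first components of the entries of `w`, read as codes of pairs. -/
def firsts (w : List ℕ) : List ℕ := w.map fun n => n.unpair.1

theorem primrec_firsts : Primrec firsts :=
  Primrec.list_map Primrec.id (Primrec.fst.comp (Primrec.unpair.comp Primrec.snd))

/-- The tree on codes of pairs whose body is `[T] × ℕ^ℕ`. -/
def comapFirsts (T : Descriptive.tree ℕ) : Descriptive.tree ℕ :=
  ⟨{w | firsts w ∈ T}, fun w a hw =>
    Descriptive.Tree.mem_of_prefix ((List.prefix_append w [a]).map _) hw⟩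

theorem mem_body_comapFirsts {z : Baire} :
    z ∈ body (comapFirsts T) ↔ (fun k => (z k).unpair.1) ∈ body T :=
  forall_congr' fun n => iff_of_eq (congrArg (· ∈ T) (map_initSeg _ z n))

theorem not_countable_body_comapFirsts (hT : (body T).Nonempty) :
    ¬ (body (comapFirsts T)).Countable := by
  obtain ⟨x, hx⟩ := hT
  let f : Baire → Baire := fun b n => Nat.pair (x n) (b n)
  have hf : Function.Injective f := fun b b' hbb => funext fun n =>
    (Nat.pair_eq_pair.1 (congrFun hbb n)).2
  have hpre : f ⁻¹' body (comapFirsts T) = Set.univ :=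
    Set.eq_univ_of_forall fun b => mem_body_comapFirsts.2 (by simpa [f] using hx)
  intro hcount
  have huniv := hcount.preimage hf
  rw [hpre, Set.countable_univ_iff, ← Cardinal.mk_le_aleph0_iff] at huniv
  exact absurd huniv (by simp [Baire, Cardinal.aleph0_lt_continuum])

end Product

/-! ### Computing a path of a pruned tree -/

section Climb

/-- The node reached after `n` steps when, going through the codes of all words in order, one
moves to each word marked by `s` that extends the current node. -/
def climb (s : Baire) : ℕ → List ℕ
  | 0 => []
  | n + 1 => if s n ≠ 0 ∧ climb s n <+: ofNat (List ℕ) n then ofNat (List ℕ) n else climb s n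

/-- The word function of the climb. -/
def climbWord (σ : List ℕ) : List ℕ := climb (fun k => σ.getD k 0) σ.length

variable {s : Baire} {T : Descriptive.tree ℕ}

theorem climb_congr {s' : Baire} {n : ℕ} (h : ∀ k < n, s k = s' k) : climb s n = climb s' n := by
  induction n with
  | zero => rfl
  | succ n ih => simp only [climb, h n n.lt_succ_self, ih fun k hk => h k (by omega)]

theorem climbWord_initSeg (s : Baire) (n : ℕ) : climbWord (initSeg s n) = climb s n := by
  rw [climbWord, initSeg_length]
  exact climb_congr fun k hk => getD_initSeg s 0 hk

theorem primrec_climbWord : Primrec climbWord := by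
  have hof := Primrec.ofNat (List ℕ)
  have hn : Primrec fun t : List ℕ × (ℕ × List ℕ) => t.2.1 := Primrec.fst.comp Primrec.snd
  have hv : Primrec fun t : List ℕ × (ℕ × List ℕ) => t.2.2 := Primrec.snd.comp Primrec.snd
  have hstep : Primrec₂ fun (σ : List ℕ) (t : ℕ × List ℕ) =>
      if σ.getD t.1 0 ≠ 0 ∧ t.2 <+: ofNat (List ℕ) t.1 then ofNat (List ℕ) t.1 else t.2 :=
    Primrec.ite ((Primrec.eq.comp ((Primrec.list_getD 0).comp Primrec.fst hn)
      (Primrec.const 0)).not.and (primrecRel_isPrefix.comp hv (hof.comp hn))) (hof.comp hn) hv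
  refine (Primrec.nat_rec' Primrec.list_length (Primrec.const []) hstep).of_eq fun σ => ?_
  rw [climbWord]
  induction σ.length with
  | zero => rfl
  | succ n ih => simp only [climb, ih]

theorem climb_prefix_succ (s : Baire) (n : ℕ) : climb s n <+: climb s (n + 1) := by
  rw [climb]
  split_ifs with h
  · exact h.2
  · exact List.prefix_refl _

theorem climb_prefix (s : Baire) {m n : ℕ} (h : m ≤ n) : climb s m <+: climb s n :=
  Nat.le_induction (List.prefix_refl _) (fun _ _ ih => ih.trans (climb_prefix_succ s _)) n h

theorem climb_mem (hs : nodes s = T) (hnil : [] ∈ T) (n : ℕ) : climb s n ∈ T := by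
  induction n with
  | zero => exact hnil
  | succ n ih =>
    rw [climb]
    split_ifs with h
    · have hmem : ofNat (List ℕ) n ∈ nodes s := by simpa only [nodes, Set.mem_ofPred_eq,
        encode_ofNat] using h.1
      rwa [hs] at hmem
    · exact ih

theorem exists_le_length_climb (hs : nodes s = T) (hT : IsPruned T) (k : ℕ) :
    ∃ n, k ≤ (climb s n).length := by
  induction k with
  | zero => exact ⟨0, Nat.zero_le _⟩
  | succ k ih =>
    obtain ⟨n, hn⟩ := ih
    obtain ⟨w, hw, hvw, hlen⟩ := hT.exists_le_length (climb_mem hs hT.1 n) (n + k + 1)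
    have hcode : n ≤ encode w := by have := length_le_encode w; omega
    -- Either the climb leaves `climb s n` before it meets `w`, or it moves to `w`.
    rcases (climb_prefix s hcode).length_le.lt_or_eq with hlt | heq
    · exact ⟨encode w, by omega⟩
    · have hstay : climb s (encode w) = climb s n :=
        ((climb_prefix s hcode).eq_of_length heq).symm
      have hmark : s (encode w) ≠ 0 := (Set.ext_iff.1 hs w).2 hw
      refine ⟨encode w + 1, ?_⟩
      rw [climb, ofNat_encode, if_pos ⟨hmark, by rwa [hstay]⟩]
      omega

theorem exists_mem_body_produces_climbWord (hs : nodes s = T) (hT : IsPruned T) :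
    ∃ z ∈ body T, Produces climbWord s z := by
  obtain ⟨z, hz⟩ := exists_produces_of_chain (φ := climbWord) (p := s)
    (by simpa only [climbWord_initSeg] using climb_prefix_succ s)
    (by simpa only [climbWord_initSeg] using exists_le_length_climb hs hT)
  refine ⟨z, fun n => ?_, hz⟩
  obtain ⟨m, hm⟩ := hz.2 n
  refine Descriptive.Tree.mem_of_prefix (initSeg_prefix z hm) ?_
  rw [← hz.1 m, climbWord_initSeg]
  exact climb_mem hs hT.1 m

end Climb

open Classical in
/-- The characteristic function of a tree whose body is `A × ℕ^ℕ`, where `A` is the closed set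
named by `q`. -/
noncomputable def productTreeName (q : Baire) : Baire := fun j =>
  if Unrefuted q (firsts (ofNat (List ℕ) j)) then 1 else 0

theorem isName_productTreeName (q : Baire) :
    treeSpace.IsName (productTreeName q) (comapFirsts (unrefutedTree q)) :=
  isName_treeSpace fun v => by
    rw [productTreeName, ofNat_encode]
    rfl

theorem isComputable_productTreeName : IsComputable (productTreeName : Baire →. Baire) := by
  classical
  refine isComputable_of_entries (g := fun j σ =>
    if Unrefuted (fun k => σ.getD k 0) (firsts (ofNat (List ℕ) j)) then 1 else 0)
    (Primrec.ite (primrecPred_unrefuted.comp (Primrec.snd.pair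
      (primrec_firsts.comp ((Primrec.ofNat (List ℕ)).comp Primrec.fst))))
      (Primrec.const 1) (Primrec.const 0)).to_comp fun q j => ?_
  have hlen : (firsts (ofNat (List ℕ) j)).length ≤ j := by
    simpa only [firsts, List.length_map, encode_ofNat] using length_le_encode (ofNat (List ℕ) j)
  exact if_congr (unrefuted_congr fun k hk => (getD_initSeg q 0 (by omega)).symm) rfl rfl

theorem closedChoice_strongWeihrauchReducible_PTT₁ :
    StrongWeihrauchReducible (closedChoice baireSpace) PTT₁ := by
  have hK : IsComputable (limitFun fun σ => firsts (climbWord σ)) :=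
    ⟨_, (primrec_firsts.comp primrec_climbWord).to_comp, fun _ _ hy => hy⟩
  refine strongWeihrauchReducible_of_transfer hK isComputable_productTreeName fun q A hq hA => ?_
  have hbody := body_unrefutedTree hq
  have huncountable : ¬ (body (comapFirsts (unrefutedTree q))).Countable :=
    not_countable_body_comapFirsts (hbody ▸ hA)
  refine ⟨_, Part.mem_some _, _, huncountable, isName_productTreeName q, ?_⟩
  rintro s T ⟨hle, hT⟩ hs
  obtain ⟨z, hzT, hz⟩ := exists_mem_body_produces_climbWord (nodes_eq_of_isName hs) hT.isPruned
  have hzA : (fun k => (z k).unpair.1) ∈ A.1 :=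
    hbody ▸ mem_body_comapFirsts.1 fun n => hle (hzT n)
  exact ⟨_, mem_limitFun.2 (hz.map _), _, hzA, rfl⟩

end Weihrauch

theorem proposition6p3_general :
    Weihrauch.StrongWeihrauchReducible Weihrauch.PTT₁
        (Weihrauch.closedChoice Weihrauch.baireSpace) ∧
      Weihrauch.StrongWeihrauchReducible (Weihrauch.closedChoice Weihrauch.baireSpace)
        Weihrauch.PTT₁ :=
  ⟨Weihrauch.PTT₁_strongWeihrauchReducible_closedChoice,
    Weihrauch.closedChoice_strongWeihrauchReducible_PTT₁⟩

theorem proposition6p3 :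
    Weihrauch.WeihrauchEquivalent Weihrauch.PTT₁
      (Weihrauch.closedChoice Weihrauch.baireSpace) :=
  ⟨proposition6p3_general.1.weihrauchReducible, proposition6p3_general.2.weihrauchReducible⟩
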